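/- Let $\tau$ be a (finitary) universal algebra signature. For a $\tau$-algebra $\mathcal A$ with underlying set $A$, let $\mathrm{Con}(\mathcal A)$ be the complete lattice of its congruences, ordered by inclusion, with least element $\Delta_{\mathcal A}=\{(a,a):a\in A\}$ and greatest element $\nabla_{\mathcal A}=A^2$. Let $\mathcal K(\mathcal A)$ be the set of finitely generated congruences of $\mathcal A$ (equivalently, the compact elements of $\mathrm{Con}(\mathcal A)$), and let $\mathcal B(\mathrm{Con}(\mathcal A))$ be the set of complemented elements of $\mathrm{Con}(\mathcal A)$, called the Boolean congruences of $\mathcal A$. The algebra $\mathcal A$ is congruence-distributive if the lattice $\mathrm{Con}(\mathcal A)$ is distributive, and it satisfies (H) if $\nabla_{\mathcal A}\in\mathcal K(\mathcal A)$. For $\theta\in\mathrm{Con}(\mathcal A)$ let $u_\theta:\mathrm{Con}(\mathcal A)\to\mathrm{Con}(\mathcal A/\theta)$ be given by $u_\theta(\alpha)=(\alpha\vee\theta)/\theta$, where $\phi/\theta=\{(a/\theta,b/\theta):(a,b)\in\phi\}$ for congruences $\phi\supseteq\theta$. If $\mathcal A$ is congruence-distributive, $u_\theta$ is a bounded lattice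 morphism and therefore restricts to a map $\mathcal B(u_\theta):\mathcal B(\mathrm{Con}(\mathcal A))\to\mathcal B(\mathrm{Con}(\mathcal A/\theta))$. The congruence $\theta$ has the Congruence Boolean Lifting Property (CBLP) if $\mathcal B(u_\theta)$ is surjective, and a congruence-distributive algebra $\mathcal A$ has CBLP if every $\theta\in\mathrm{Con}(\mathcal A)$ has CBLP. A discriminator term on a $\tau$-algebra $\mathcal M$ is a ternary $\tau$-term $t$ such that, for all $a,b,c$ in $\mathcal M$, $t^{\mathcal M}(a,b,c)=a$ if $a\neq b$ and $t^{\mathcal M}(a,b,c)=c$ if $a=b$. An equational class (a class of $\tau$-algebras defined by a set of identities) is a discriminator equational class if it is generated, as an equational class, by a class of $\tau$-algebras that have a common discriminator term. **Statement.** Let $\mathcal D$ be a discriminator equational class of $\tau$-algebras and let $\mathcal A\in\mathcal D$ be a non-empty algebra that satisfies (H). Then $\mathcal A$ is congruence-distributive, its Boolean congruences are exactly its compact congruences, that is, $\mathcal B(\mathrm{Con}(\mathcal A))=\mathcal K(\mathcal A)$, and $\mathcal A$ has CBLP. -/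

import Mathlib

universe u v w

namespace UnivAlg

open FirstOrder FirstOrder.Language FirstOrder.Language.Structure

/-! Algebras of signature `L` are the structures of a first-order language `L` without relation
symbols (`L.IsAlgebraic`); classes of algebras are sets of bundled structures, and their members
may be empty. -/

section Congruences

variable (L : FirstOrder.Language.{u, v}) (M : Type w) [L.Structure M]

/-- Congruences: equivalence relations compatible with all the operations. -/
@[ext]
structure Congruence extends Setoid M where
  compat : ∀ {n : ℕ} (f : L.Functions n) (x y : Fin n → M),
    (∀ i, toSetoid (x i) (y i)) → toSetoid (funMap f x) (funMap f y)

variable {L M}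

namespace Congruence

/-- Congruences are ordered by inclusion. -/
instance : PartialOrder (Congruence L M) where
  le θ φ := ∀ a b, θ.toSetoid a b → φ.toSetoid a b
  le_refl _ _ _ h := h
  le_trans _ _ _ h₁ h₂ a b h := h₂ a b (h₁ a b h)
  le_antisymm θ φ h₁ h₂ :=
    Congruence.ext (funext fun a => funext fun b => propext ⟨h₁ a b, h₂ a b⟩)

/-- Arbitrary meets are intersections. -/
instance : InfSet (Congruence L M) where
  sInf S :=
    { r := fun a b => ∀ θ ∈ S, θ.toSetoid a b
      iseqv := ⟨fun _ φ _ => φ.iseqv.refl _, fun h θ hθ => θ.iseqv.symm (h θ hθ),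
        fun h₁ h₂ θ hθ => θ.iseqv.trans (h₁ θ hθ) (h₂ θ hθ)⟩
      compat := fun f x y h θ hθ => θ.compat f x y fun i => h i θ hθ }

theorem isGLB_sInf (S : Set (Congruence L M)) : IsGLB S (sInf S) :=
  ⟨fun θ hθ _ _ h => h θ hθ, fun _ hφ a b h θ hθ => hφ hθ a b h⟩

/-- The complete lattice of congruences; the bottom is the equality and the top is the
full relation. -/
instance : CompleteLattice (Congruence L M) :=
  { completeLatticeOfInf (Congruence L M) isGLB_sInf with
    bot :=
      { r := fun a b => a = b
        iseqv := ⟨fun _ => rfl, fun h => h.symm, fun h₁ h₂ => h₁.trans h₂⟩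
        compat := fun f x y h => congrArg (funMap f) (funext h) }
    bot_le := fun θ a b h => by
      have h' : a = b := h
      exact h' ▸ θ.iseqv.refl a
    top :=
      { r := fun _ _ => True
        iseqv := ⟨fun _ => trivial, fun _ => trivial, fun _ _ => trivial⟩
        compat := fun _ _ _ _ => trivial }
    le_top := fun _ _ _ _ => trivial }

/-- The congruence generated by a set of pairs. -/
def gen (X : Set (M × M)) : Congruence L M :=
  sInf {θ | ∀ p ∈ X, θ.toSetoid p.1 p.2}

/-- The quotient algebra: operations are computed on representatives. -/
instance [L.IsAlgebraic] (θ : Congruence L M) : L.Prestructure θ.toSetoid where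
  toStructure := inferInstance
  fun_equiv {_ f} x y h := θ.compat f x y h
  rel_equiv {_ r} := isEmptyElim r

/-- For congruences `θ ≤ φ`, the congruence `φ / θ` of the quotient algebra modulo `θ`,
consisting of the pairs of classes of pairs from `φ`. -/
def quot [L.IsAlgebraic] (θ φ : Congruence L M) (h : θ ≤ φ) :
    Congruence L (Quotient θ.toSetoid) where
  r x y := ∃ a b : M, φ.toSetoid a b ∧
    Quotient.mk θ.toSetoid a = x ∧ Quotient.mk θ.toSetoid b = y
  iseqv := by
    refine ⟨fun x => ?_, ?_, ?_⟩
    · obtain ⟨a, rfl⟩ := Quotient.exists_rep x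
      exact ⟨a, a, φ.iseqv.refl a, rfl, rfl⟩
    · rintro x y ⟨a, b, hab, rfl, rfl⟩
      exact ⟨b, a, φ.iseqv.symm hab, rfl, rfl⟩
    · rintro x y z ⟨a, b, hab, rfl, rfl⟩ ⟨c, d, hcd, hcb, rfl⟩
      have hcb' : φ.toSetoid c b := h c b (Quotient.exact hcb)
      exact ⟨a, d, φ.iseqv.trans hab (φ.iseqv.trans (φ.iseqv.symm hcb') hcd), rfl, rfl⟩
  compat {n} f x y hxy := by
    choose a b hab ha hb using hxy
    refine ⟨funMap f a, funMap f b, φ.compat f a b hab, ?_, ?_⟩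
    · rw [← funext ha]
      exact (funMap_quotient_mk' θ.toSetoid f a).symm
    · rw [← funext hb]
      exact (funMap_quotient_mk' θ.toSetoid f b).symm

/-- The map `α ↦ (α ∨ θ) / θ` from the congruences of an algebra to those of its quotient
by `θ`. -/
def toQuot [L.IsAlgebraic] (θ α : Congruence L M) : Congruence L (Quotient θ.toSetoid) :=
  quot θ (α ⊔ θ) le_sup_right

end Congruence

variable (L M)

/-- The finitely generated congruences; these are exactly the compact elements of the lattice of
congruences, see `mem_compactCongruences_iff`. -/
def compactCongruences : Set (Congruence L M) :=
  {θ | ∃ X : Set (M × M), X.Finite ∧ θ = Congruence.gen X}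

/-- The Boolean congruences: the complemented elements of the lattice of congruences. -/
def booleanCongruences : Set (Congruence L M) :=
  {θ | IsComplemented θ}

/-- The lattice of congruences is distributive. -/
def CongruenceDistributive : Prop :=
  ∀ α β γ : Congruence L M, α ⊓ (β ⊔ γ) = (α ⊓ β) ⊔ (α ⊓ γ)

/-- Hypothesis (H): the full relation is a finitely generated (compact) congruence. -/
def HypH : Prop :=
  (⊤ : Congruence L M) ∈ compactCongruences L M

variable {L M} in
/-- A congruence `θ` has the Congruence Boolean Lifting Property when `α ↦ (α ∨ θ) / θ` maps the
Boolean congruences of the algebra onto those of its quotient by `θ`. -/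
def Congruence.HasCBLP [L.IsAlgebraic] (θ : Congruence L M) : Prop :=
  θ.toQuot '' booleanCongruences L M = booleanCongruences L (Quotient θ.toSetoid)

/-- An algebra has CBLP when all its congruences do. -/
def HasCBLP [L.IsAlgebraic] : Prop :=
  ∀ θ : Congruence L M, θ.HasCBLP

variable {L M}

theorem Congruence.gen_le_iff {X : Set (M × M)} {θ : Congruence L M} :
    Congruence.gen X ≤ θ ↔ ∀ p ∈ X, θ.toSetoid p.1 p.2 :=
  ⟨fun h p hp => h _ _ fun _ hφ => hφ p hp, fun h => sInf_le h⟩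

/-- The union of a nonempty directed set of congruences. -/
def Congruence.dirUnion (S : Set (Congruence L M)) (hS : S.Nonempty)
    (hd : DirectedOn (· ≤ ·) S) : Congruence L M where
  r a b := ∃ θ ∈ S, θ.toSetoid a b
  iseqv := by
    refine ⟨fun a => ?_, ?_, ?_⟩
    · obtain ⟨θ, hθ⟩ := hS
      exact ⟨θ, hθ, θ.iseqv.refl a⟩
    · rintro a b ⟨θ, hθ, h⟩
      exact ⟨θ, hθ, θ.iseqv.symm h⟩
    · rintro a b c ⟨θ, hθ, h⟩ ⟨φ, hφ, h'⟩
      obtain ⟨ψ, hψ, h₁, h₂⟩ := hd θ hθ φ hφ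
      exact ⟨ψ, hψ, ψ.iseqv.trans (h₁ _ _ h) (h₂ _ _ h')⟩
  compat {n} f x y h := by
    choose θ hθ hxy using h
    have : Nonempty S := hS.to_subtype
    have hd' : Directed (· ≤ ·) (fun s : S => s.1) := hd.directed_val
    obtain ⟨ψ, hψ⟩ := hd'.finite_le fun i => ⟨θ i, hθ i⟩
    exact ⟨ψ.1, ψ.2, ψ.1.compat f x y fun i => hψ i _ _ (hxy i)⟩

theorem mem_compactCongruences_iff (θ : Congruence L M) :
    θ ∈ compactCongruences L M ↔ IsCompactElement θ := by
  constructor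
  · rintro ⟨X, hX, rfl⟩ S φ hS hd hφ hle
    have hU : φ ≤ Congruence.dirUnion S hS hd := hφ.2 fun ψ hψ a b h => ⟨ψ, hψ, h⟩
    have : Nonempty S := hS.to_subtype
    have : Finite X := hX
    have hX' : ∀ p : X, ∃ s : S, s.1.toSetoid p.1.1 p.1.2 := fun p => by
      obtain ⟨ψ, hψ, h⟩ := hU _ _ (Congruence.gen_le_iff.1 hle p.1 p.2)
      exact ⟨⟨ψ, hψ⟩, h⟩
    choose g hg using hX'
    have hd' : Directed (· ≤ ·) (fun s : S => s.1) := hd.directed_val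
    obtain ⟨ψ, hψ⟩ := hd'.finite_le g
    exact ⟨ψ.1, ψ.2, Congruence.gen_le_iff.2 fun p hp => hψ ⟨p, hp⟩ _ _ (hg ⟨p, hp⟩)⟩
  · intro h
    obtain ⟨φ, ⟨X, hX, hXθ, rfl⟩, hle⟩ := h
      {φ | ∃ X : Set (M × M), X.Finite ∧ (∀ p ∈ X, θ.toSetoid p.1 p.2) ∧ φ = Congruence.gen X} θ
      ⟨_, ∅, Set.finite_empty, by simp, rfl⟩
      (by
        rintro _ ⟨X, hX, hXθ, rfl⟩ _ ⟨Y, hY, hYθ, rfl⟩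
        refine ⟨_, ⟨X ∪ Y, hX.union hY, ?_, rfl⟩, ?_, ?_⟩
        · rintro p (hp | hp)
          exacts [hXθ p hp, hYθ p hp]
        · exact Congruence.gen_le_iff.2 fun p hp =>
            Congruence.gen_le_iff.1 le_rfl p (Or.inl hp)
        · exact Congruence.gen_le_iff.2 fun p hp =>
            Congruence.gen_le_iff.1 le_rfl p (Or.inr hp))
      (by
        refine ⟨?_, fun ψ hψ a b hab => ?_⟩
        · rintro _ ⟨X, _, hXθ, rfl⟩
          exact Congruence.gen_le_iff.2 hXθ
        · have := hψ ⟨{(a, b)}, Set.finite_singleton _, by simpa using hab, rfl⟩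
          exact Congruence.gen_le_iff.1 this (a, b) rfl)
      le_rfl
    exact ⟨X, hX, le_antisymm hle (Congruence.gen_le_iff.2 hXθ)⟩

end Congruences

section Classes

variable {L : FirstOrder.Language.{u, v}}

/-- The class of all algebras satisfying a set `E` of identities, written as pairs of terms in
countably many variables. -/
def modelsOf (E : Set (L.Term ℕ × L.Term ℕ)) : Set (CategoryTheory.Bundled.{w} L.Structure) :=
  {M | ∀ e ∈ E, ∀ x : ℕ → M, e.1.realize x = e.2.realize x}

/-- Equational classes: those defined by a set of identities. -/
def IsEquationalClass (D : Set (CategoryTheory.Bundled.{w} L.Structure)) : Prop :=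
  ∃ E : Set (L.Term ℕ × L.Term ℕ), D = modelsOf E

open Classical in
/-- `t(a, b, c) = a` if `a ≠ b` and `t(a, b, c) = c` if `a = b`. -/
def IsDiscriminatorTerm (t : L.Term (Fin 3)) (M : Type w) [L.Structure M] : Prop :=
  ∀ a b c : M, t.realize ![a, b, c] = if a ≠ b then a else c

/-- Discriminator equational classes: the equational classes generated by a class `K` of algebras
with a common discriminator term. -/
def IsDiscriminatorClass (D : Set (CategoryTheory.Bundled.{w} L.Structure)) : Prop :=
  ∃ (K : Set (CategoryTheory.Bundled.{w} L.Structure)) (t : L.Term (Fin 3)),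
    (∀ M ∈ K, IsDiscriminatorTerm t M) ∧ IsLeast {C | IsEquationalClass C ∧ K ⊆ C} D

end Classes

end UnivAlg

/-! An identity true in every algebra with discriminator term `t` is true throughout the class, so
each property of `t` used below is put as an identity and checked where `a = b` or `a ≠ b` can be
decided. The Pixley identities `t(a,a,b) = b`, `t(a,b,b) = a`, `t(a,b,a) = a` make congruences
permute and their lattice distributive.

Put `d x = t(a,b,x)` and `c x = t(a, d x, x)`. Over a discriminator, one of `d`, `c` is the identity
and the other is constantly `a`. As identities this says that their kernels are complementary
congruences, and the kernel of `d` is the one generated by `(a,b)` (`gen_singleton`,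
`isComplemented_gen_singleton`). By distributivity finite joins of principal congruences are
complemented, so compact implies Boolean; (H) gives the converse.

Quotients inherit the identities and (H), so Boolean means compact there too. CBLP thus reduces to
lifting finite generating sets (`image_toQuot_compactCongruences`). -/

namespace UnivAlg

open FirstOrder FirstOrder.Language FirstOrder.Language.Structure

/-! ### Permutability, distributivity and generated congruences. -/

section Congruences

variable {L : FirstOrder.Language.{u, v}} {M : Type w} [L.Structure M]

namespace Congruence

/-- Congruences are compatible with all term operations. -/
theorem realize_compat (θ : Congruence L M) {β : Type*} (p : L.Term β) {x y : β → M}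
    (h : ∀ i, θ.toSetoid (x i) (y i)) : θ.toSetoid (p.realize x) (p.realize y) := by
  induction p with
  | var i => exact h i
  | func f ts ih => exact θ.compat f _ _ ih

theorem realize_fin_three_compat (θ : Congruence L M) (t : L.Term (Fin 3)) {a b c a' b' c' : M}
    (ha : θ.toSetoid a a') (hb : θ.toSetoid b b') (hc : θ.toSetoid c c') :
    θ.toSetoid (t.realize ![a, b, c]) (t.realize ![a', b', c']) :=
  θ.realize_compat t fun i => by fin_cases i <;> assumption

theorem mem_gen {X : Set (M × M)} {p : M × M} (hp : p ∈ X) :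
    (gen (L := L) X).toSetoid p.1 p.2 :=
  gen_le_iff.1 le_rfl p hp

theorem gen_insert (p : M × M) (X : Set (M × M)) :
    gen (L := L) (insert p X) = gen {p} ⊔ gen X := by
  apply le_antisymm
  · rw [gen_le_iff]
    rintro q (rfl | hq)
    · exact (le_sup_left : gen (L := L) {q} ≤ _) _ _ (mem_gen rfl)
    · exact (le_sup_right : gen (L := L) X ≤ _) _ _ (mem_gen hq)
  · refine sup_le ?_ ?_ <;> rw [gen_le_iff]
    · rintro q rfl
      exact mem_gen (Or.inl rfl)
    · exact fun q hq => mem_gen (Or.inr hq)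

/-- The kernel of a map `e` that is compatible with the operations modulo `e` itself. -/
def ofMap (e : M → M) (he : ∀ {n : ℕ} (f : L.Functions n) (x : Fin n → M),
    e (funMap f x) = e (funMap f fun i => e (x i))) : Congruence L M where
  r a b := e a = e b
  iseqv := ⟨fun _ => rfl, fun h => h.symm, fun h₁ h₂ => h₁.trans h₂⟩
  compat f x y h := by
    rw [he f x, he f y]
    exact congrArg (fun z => e (funMap f z)) (funext h)

/-- The composite of two congruences, in the presence of a Mal'cev term. -/
def comp (t : L.Term (Fin 3)) (h₁ : ∀ a b : M, t.realize ![a, a, b] = b)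
    (h₂ : ∀ a b : M, t.realize ![a, b, b] = a) (β γ : Congruence L M) : Congruence L M where
  r a b := ∃ c, β.toSetoid a c ∧ γ.toSetoid c b
  iseqv := by
    -- Permutability: `t(a,c,b)` is `γ`-related to `t(a,c,c) = a` and `β`-related to `t(c,c,b) = b`.
    have swap : ∀ (β γ : Congruence L M) {a b c : M}, β.toSetoid a c → γ.toSetoid c b →
        ∃ d, γ.toSetoid a d ∧ β.toSetoid d b := by
      intro β γ a b c hac hcb
      refine ⟨t.realize ![a, c, b], ?_, ?_⟩
      · have := γ.realize_fin_three_compat t (γ.iseqv.refl a) (γ.iseqv.refl c) hcb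
        rwa [h₂] at this
      · have := β.realize_fin_three_compat t hac (β.iseqv.refl c) (β.iseqv.refl b)
        rwa [h₁] at this
    refine ⟨fun a => ⟨a, β.iseqv.refl a, γ.iseqv.refl a⟩, ?_, ?_⟩
    · rintro a b ⟨c, hac, hcb⟩
      exact swap γ β (γ.iseqv.symm hcb) (β.iseqv.symm hac)
    · rintro a b c ⟨d, had, hdb⟩ ⟨e, hbe, hec⟩
      obtain ⟨g, hdg, hge⟩ := swap γ β hdb hbe
      exact ⟨g, β.iseqv.trans had hdg, γ.iseqv.trans hge hec⟩
  compat f x y h := by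
    choose z hz hz' using h
    exact ⟨funMap f z, β.compat f x z hz, γ.compat f z y hz'⟩

theorem sup_apply_iff {t : L.Term (Fin 3)} (h₁ : ∀ a b : M, t.realize ![a, a, b] = b)
    (h₂ : ∀ a b : M, t.realize ![a, b, b] = a) {β γ : Congruence L M} {a b : M} :
    (β ⊔ γ).toSetoid a b ↔ ∃ c, β.toSetoid a c ∧ γ.toSetoid c b := by
  constructor
  · have : β ⊔ γ ≤ comp t h₁ h₂ β γ :=
      sup_le (fun a b h => ⟨b, h, γ.iseqv.refl b⟩) (fun a b h => ⟨a, β.iseqv.refl a, h⟩)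
    exact this a b
  · rintro ⟨c, hac, hcb⟩
    exact (β ⊔ γ).iseqv.trans ((le_sup_left : β ≤ β ⊔ γ) _ _ hac)
      ((le_sup_right : γ ≤ β ⊔ γ) _ _ hcb)

theorem inf_apply {α β : Congruence L M} {a b : M} (hα : α.toSetoid a b) (hβ : β.toSetoid a b) :
    (α ⊓ β).toSetoid a b := by
  have h : gen {(a, b)} ≤ α ⊓ β :=
    le_inf (gen_le_iff.2 (by rintro _ rfl; exact hα)) (gen_le_iff.2 (by rintro _ rfl; exact hβ))
  exact gen_le_iff.1 h (a, b) rfl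

theorem toQuot_top [L.IsAlgebraic] (θ : Congruence L M) : θ.toQuot ⊤ = ⊤ := by
  refine top_unique fun x y _ => ?_
  obtain ⟨a, rfl⟩ := Quotient.exists_rep x
  obtain ⟨b, rfl⟩ := Quotient.exists_rep y
  exact ⟨a, b, (le_sup_left : (⊤ : Congruence L M) ≤ ⊤ ⊔ θ) a b trivial, rfl, rfl⟩

/-- The pullback of a congruence along the projection onto a quotient algebra. -/
def comapMk [L.IsAlgebraic] (θ : Congruence L M) (ψ : Congruence L (Quotient θ.toSetoid)) :
    Congruence L M where
  r a b := ψ.toSetoid (Quotient.mk _ a) (Quotient.mk _ b)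
  iseqv := ⟨fun _ => ψ.iseqv.refl _, fun h => ψ.iseqv.symm h, fun h h' => ψ.iseqv.trans h h'⟩
  compat f x y h := by
    have := ψ.compat f _ _ h
    rwa [funMap_quotient_mk' θ.toSetoid f x, funMap_quotient_mk' θ.toSetoid f y] at this

/-- The pullback of the right-hand side contains both `X` and `θ`, hence their join. This is what
carries finite generation to quotients. -/
theorem toQuot_gen [L.IsAlgebraic] (θ : Congruence L M) (X : Set (M × M)) :
    θ.toQuot (gen X) =
      gen (Prod.map (Quotient.mk θ.toSetoid) (Quotient.mk θ.toSetoid) '' X) := by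
  apply le_antisymm
  · have h : gen X ⊔ θ ≤ θ.comapMk
        (gen (Prod.map (Quotient.mk θ.toSetoid) (Quotient.mk θ.toSetoid) '' X)) := by
      refine sup_le (gen_le_iff.2 fun p hp => ?_) fun a b hab => ?_
      · exact mem_gen (L := L) (Set.mem_image_of_mem _ hp)
      · have e : Quotient.mk θ.toSetoid a = Quotient.mk θ.toSetoid b := Quotient.sound hab
        change (gen _).toSetoid (Quotient.mk _ a) (Quotient.mk _ b)
        rw [e]
    rintro _ _ ⟨a, b, hab, rfl, rfl⟩
    exact h a b hab
  · rw [gen_le_iff]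
    rintro _ ⟨p, hp, rfl⟩
    exact ⟨p.1, p.2, (le_sup_left : gen X ≤ gen X ⊔ θ) _ _ (mem_gen hp), rfl, rfl⟩

end Congruence

/-- If `a β c γ b` and `a α b`, then `t(a,c,b)` is `γ`-related to `a`, `β`-related to `b` and
`α`-related to both. The factors come out in the order `γ`, `β`, so the join has to be commuted. -/
theorem congruenceDistributive_of_pixley {t : L.Term (Fin 3)}
    (h₁ : ∀ a b : M, t.realize ![a, a, b] = b) (h₂ : ∀ a b : M, t.realize ![a, b, b] = a)
    (h₃ : ∀ a b : M, t.realize ![a, b, a] = a) : CongruenceDistributive L M := by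
  intro α β γ
  refine le_antisymm (fun a b hab => ?_) le_inf_sup
  have hα : α.toSetoid a b := (inf_le_left : α ⊓ (β ⊔ γ) ≤ α) _ _ hab
  obtain ⟨c, hac, hcb⟩ :=
    (Congruence.sup_apply_iff h₁ h₂).1 ((inf_le_right : α ⊓ (β ⊔ γ) ≤ β ⊔ γ) _ _ hab)
  rw [sup_comm, Congruence.sup_apply_iff h₁ h₂]
  have hα' := α.realize_fin_three_compat t (α.iseqv.refl a) (α.iseqv.refl c) hα
  rw [h₃] at hα'
  have hβ' := β.realize_fin_three_compat t hac (β.iseqv.refl c) (β.iseqv.refl b)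
  rw [h₁] at hβ'
  have hγ' := γ.realize_fin_three_compat t (γ.iseqv.refl a) (γ.iseqv.refl c) hcb
  rw [h₂] at hγ'
  exact ⟨_, Congruence.inf_apply hα' hγ',
    Congruence.inf_apply (α.iseqv.trans (α.iseqv.symm hα') hα) hβ'⟩

/-- Distributivity as a structure on the lattice of congruences. -/
abbrev CongruenceDistributive.distribLattice (h : CongruenceDistributive L M) :
    DistribLattice (Congruence L M) :=
  DistribLattice.ofInfSupLe fun α β γ => (h α β γ).le

/-- In a congruence-distributive algebra with a Mal'cev term satisfying (H), Boolean congruences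
are compact. -/
theorem booleanCongruences_subset {t : L.Term (Fin 3)}
    (h₁ : ∀ a b : M, t.realize ![a, a, b] = b) (h₂ : ∀ a b : M, t.realize ![a, b, b] = a)
    (hd : CongruenceDistributive L M) (hH : HypH L M) :
    booleanCongruences L M ⊆ compactCongruences L M := by
  rintro α ⟨β, hαβ⟩
  obtain ⟨X, hX, htop⟩ := hH
  have hz : ∀ p : M × M, ∃ z, α.toSetoid p.1 z ∧ β.toSetoid z p.2 := fun p => by
    rw [← Congruence.sup_apply_iff h₁ h₂, hαβ.sup_eq_top]
    trivial
  choose z hz hz' using hz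
  -- These pairs generate some `α' ≤ α` with `α' ⊔ β = ⊤`; distributivity then gives `α = α ⊓ (α' ⊔
  -- β) = α'`.
  refine ⟨(fun p => (p.1, z p)) '' X, hX.image _, ?_⟩
  have hle : Congruence.gen ((fun p => (p.1, z p)) '' X) ≤ α := by
    rw [Congruence.gen_le_iff]
    rintro _ ⟨p, _, rfl⟩
    exact hz p
  have hsup : Congruence.gen ((fun p => (p.1, z p)) '' X) ⊔ β = ⊤ := by
    rw [eq_top_iff, htop, Congruence.gen_le_iff]
    exact fun p hp => (Congruence.sup_apply_iff h₁ h₂).2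
      ⟨z p, Congruence.mem_gen (L := L) (Set.mem_image_of_mem _ hp), hz' p⟩
  have := hd α (Congruence.gen ((fun p => (p.1, z p)) '' X)) β
  rwa [hsup, hαβ.inf_eq_bot, inf_top_eq, sup_bot_eq, inf_eq_right.2 hle] at this

/-- If all principal congruences of a congruence-distributive algebra are complemented, so are the
compact ones. -/
theorem compactCongruences_subset (hd : CongruenceDistributive L M)
    (h : ∀ p : M × M, IsComplemented (Congruence.gen (L := L) {p})) :
    compactCongruences L M ⊆ booleanCongruences L M := by
  rintro _ ⟨X, hX, rfl⟩
  change IsComplemented _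
  induction X, hX using Set.Finite.induction_on with
  | empty =>
    have : Congruence.gen (L := L) (∅ : Set (M × M)) = ⊥ :=
      le_bot_iff.1 (Congruence.gen_le_iff.2 (by simp))
    rw [this]
    exact isComplemented_bot
  | @insert p X _ _ ih =>
    rw [Congruence.gen_insert]
    obtain ⟨β, hβ⟩ := h p
    obtain ⟨γ, hγ⟩ := ih
    let _ := hd.distribLattice
    refine ⟨β ⊓ γ, IsCompl.of_eq ?_ ?_⟩
    · exact (hβ.sup_inf hγ).inf_eq_bot
    · exact (hβ.sup_inf hγ).sup_eq_top

end Congruences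

/-! ### Transfer of identities from algebras with a discriminator term. -/

section Discriminator

variable {L : FirstOrder.Language.{u, v}}

/-- `M` satisfies every identity that holds in all algebras (of the same universe) on which `t` is
a discriminator term. -/
def SatisfiesDiscriminatorIdentities (t : L.Term (Fin 3)) (M : Type w) [L.Structure M] : Prop :=
  ∀ p q : L.Term ℕ, (∀ (N : Type w) [L.Structure N], IsDiscriminatorTerm t N →
    ∀ x : ℕ → N, p.realize x = q.realize x) → ∀ x : ℕ → M, p.realize x = q.realize x

/-- The models of a single identity form an equational class; if the identity holds in the
generators, minimality puts `D` inside it. -/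
theorem IsDiscriminatorClass.exists_term
    {D : Set (CategoryTheory.Bundled.{w} L.Structure)} (hD : IsDiscriminatorClass D) :
    ∃ t : L.Term (Fin 3), ∀ A ∈ D, SatisfiesDiscriminatorIdentities t A := by
  obtain ⟨K, t, hK, -, hmin⟩ := hD
  refine ⟨t, fun A hA p q hpq => ?_⟩
  have hle : D ≤ modelsOf {(p, q)} := hmin
    ⟨⟨_, rfl⟩, fun N hN e he x => by
      obtain rfl : e = (p, q) := he
      exact hpq N (hK N hN) x⟩
  exact hle hA (p, q) rfl

namespace SatisfiesDiscriminatorIdentities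

variable {t : L.Term (Fin 3)} {M : Type w} [L.Structure M]

theorem quotient [L.IsAlgebraic] (h : SatisfiesDiscriminatorIdentities t M)
    (θ : Congruence L M) : SatisfiesDiscriminatorIdentities t (Quotient θ.toSetoid) := by
  intro p q hpq x
  choose y hy using fun i => Quotient.exists_rep (x i)
  obtain rfl : (fun i => Quotient.mk θ.toSetoid (y i)) = x := funext hy
  have hp := Term.realize_quotient_mk' θ.toSetoid p y
  have hq := Term.realize_quotient_mk' θ.toSetoid q y
  refine hp.trans (Eq.trans ?_ hq.symm)
  exact congrArg (Quotient.mk θ.toSetoid) (h p q hpq y)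

/-- Allows other countable sets of variables in place of `ℕ`. Non-emptiness supplies values for the
variables outside the range of the encoding. -/
theorem realize_eq [Nonempty M] (h : SatisfiesDiscriminatorIdentities t M) {β : Type*}
    [Encodable β] (p q : L.Term β) (hpq : ∀ (N : Type w) [L.Structure N],
      IsDiscriminatorTerm t N → ∀ x : β → N, p.realize x = q.realize x) (x : β → M) :
    p.realize x = q.realize x := by
  have := h (p.relabel Encodable.encode) (q.relabel Encodable.encode)
    (fun N _ hN y => by simpa only [Term.realize_relabel] using hpq N hN _)
    (Function.extend Encodable.encode x fun _ => Classical.arbitrary M)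
  simpa only [Term.realize_relabel, Function.extend_comp Encodable.encode_injective] using this

end SatisfiesDiscriminatorIdentities

/-- Lets `simp` see that `t(a,x,x)` collapses to `a` over a discriminator. -/
theorem ite_eq_then_right_else_left {α : Type*} (a b : α) [Decidable (a = b)] :
    (if a = b then b else a) = a := by
  split_ifs with h
  exacts [h.symm, rfl]

/-- The term `t(p, q, r)`. -/
def tern (t : L.Term (Fin 3)) {β : Type*} (p q r : L.Term β) : L.Term β :=
  t.subst ![p, q, r]

theorem realize_tern (t : L.Term (Fin 3)) {β : Type*} (p q r : L.Term β) {M : Type w}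
    [L.Structure M] (x : β → M) :
    (tern t p q r).realize x = t.realize ![p.realize x, q.realize x, r.realize x] := by
  rw [tern, Term.realize_subst]
  congr 1
  ext i
  fin_cases i <;> rfl

/-! ### Principal congruences and their complements. -/

namespace SatisfiesDiscriminatorIdentities

variable {t : L.Term (Fin 3)} {M : Type w} [L.Structure M] [Nonempty M]

theorem left_eq (h : SatisfiesDiscriminatorIdentities t M) (a b : M) :
    t.realize ![a, a, b] = b := by
  have := h.realize_eq (tern t (.var 0) (.var 0) (.var 1)) (.var (1 : Fin 2))
    (fun N _ hN x => by simp [realize_tern, hN _ _ _]) ![a, b]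
  simpa [realize_tern] using this

theorem right_eq (h : SatisfiesDiscriminatorIdentities t M) (a b : M) :
    t.realize ![a, b, b] = a := by
  have := h.realize_eq (tern t (.var 0) (.var 1) (.var 1)) (.var (0 : Fin 2))
    (fun N _ hN x => by
      by_cases e : x 0 = x 1 <;> simp [realize_tern, hN _ _ _, e]) ![a, b]
  simpa [realize_tern] using this

theorem outer_eq (h : SatisfiesDiscriminatorIdentities t M) (a b : M) :
    t.realize ![a, b, a] = a := by
  have := h.realize_eq (tern t (.var 0) (.var 1) (.var 0)) (.var (0 : Fin 2))
    (fun N _ hN x => by simp [realize_tern, hN _ _ _]) ![a, b]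
  simpa [realize_tern] using this

/-- Over a discriminator `t(a,b,·)` is the identity or constant. This is the hypothesis that makes
its kernel a congruence through `ofMap`. -/
theorem funMap_eq (h : SatisfiesDiscriminatorIdentities t M) (a b : M) {n : ℕ}
    (f : L.Functions n) (x : Fin n → M) :
    t.realize ![a, b, funMap f x] =
      t.realize ![a, b, funMap f fun i => t.realize ![a, b, x i] ] := by
  have := h.realize_eq
    (tern t (.var (.inl 0)) (.var (.inl 1)) (.func f fun i => .var (.inr i)))
    (tern t (.var (.inl 0)) (.var (.inl 1)) (.func f fun i =>
      tern t (.var (.inl 0)) (.var (.inl 1)) (.var (.inr i) : L.Term (Fin 2 ⊕ Fin n))))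
    (fun N _ hN x => by
      by_cases e : x (.inl 0) = x (.inl 1) <;> simp [realize_tern, hN _ _ _, e])
    (Sum.elim ![a, b] x)
  simpa [realize_tern] using this

/-- The same for `c x = t(a, t(a,b,x), x)`, which is constantly `a` when `a = b` and the identity
when `a ≠ b`. -/
theorem funMap_compl_eq (h : SatisfiesDiscriminatorIdentities t M) (a b : M) {n : ℕ}
    (f : L.Functions n) (x : Fin n → M) :
    t.realize ![a, t.realize ![a, b, funMap f x], funMap f x] =
      t.realize ![a,
        t.realize ![a, b, funMap f fun i => t.realize ![a, t.realize ![a, b, x i], x i] ],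
        funMap f fun i => t.realize ![a, t.realize ![a, b, x i], x i] ] := by
  let c (r : L.Term (Fin 2 ⊕ Fin n)) : L.Term (Fin 2 ⊕ Fin n) :=
    tern t (.var (.inl 0)) (tern t (.var (.inl 0)) (.var (.inl 1)) r) r
  have := h.realize_eq (c (.func f fun i => .var (.inr i)))
    (c (.func f fun i => c (.var (.inr i))))
    (fun N _ hN x => by
      by_cases e : x (.inl 0) = x (.inl 1) <;> simp [c, realize_tern, hN _ _ _, e, ite_eq_then_right_else_left])
    (Sum.elim ![a, b] x)
  simpa [c, realize_tern] using this

/-- Since `x` is a function of `d x` and `c x`, the two kernels meet in equality. Over a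
discriminator the left side is `t(x,a,a)` if `a = b` and `t(a,a,x)` otherwise. -/
theorem recover_eq (h : SatisfiesDiscriminatorIdentities t M) (a b x : M) :
    t.realize ![t.realize ![a, b, t.realize ![a, b, x] ],
      t.realize ![a, b, t.realize ![a, t.realize ![a, b, x], x] ],
      t.realize ![a, t.realize ![a, b, x], x] ] = x := by
  let d (r : L.Term (Fin 3)) : L.Term (Fin 3) := tern t (.var 0) (.var 1) r
  let c : L.Term (Fin 3) := tern t (.var 0) (d (.var 2)) (.var 2)
  have := h.realize_eq (tern t (d (d (.var 2))) (d c) c) (.var 2)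
    (fun N _ hN x => by
      by_cases e : x 0 = x 1 <;> by_cases e' : x 1 = x 2 <;>
        simp [c, d, realize_tern, hN _ _ _, e, e', ite_eq_then_right_else_left])
    ![a, b, x]
  simpa [c, d, realize_tern] using this

/-- The element `s = t(d x, d y, y)` is `x` when `a = b` and `y` when `a ≠ b`, so `d s = d x` and
(next lemma) `c s = c y`. It links `x` to `y` through the two kernels, whose join is therefore full.
-/
theorem switch_left_eq (h : SatisfiesDiscriminatorIdentities t M) (a b x y : M) :
    t.realize ![a, b, t.realize ![t.realize ![a, b, x], t.realize ![a, b, y], y] ] =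
      t.realize ![a, b, x] := by
  let d (r : L.Term (Fin 4)) : L.Term (Fin 4) := tern t (.var 0) (.var 1) r
  have := h.realize_eq (d (tern t (d (.var 2)) (d (.var 3)) (.var 3))) (d (.var 2))
    (fun N _ hN x => by
      by_cases e : x 0 = x 1 <;> by_cases e' : x 2 = x 3 <;>
        simp [d, realize_tern, hN _ _ _, e, e'])
    ![a, b, x, y]
  simpa [d, realize_tern] using this

theorem switch_right_eq (h : SatisfiesDiscriminatorIdentities t M) (a b x y : M) :
    t.realize ![a,
      t.realize ![a, b, t.realize ![t.realize ![a, b, x], t.realize ![a, b, y], y] ],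
      t.realize ![t.realize ![a, b, x], t.realize ![a, b, y], y] ] =
      t.realize ![a, t.realize ![a, b, y], y] := by
  let d (r : L.Term (Fin 4)) : L.Term (Fin 4) := tern t (.var 0) (.var 1) r
  let s : L.Term (Fin 4) := tern t (d (.var 2)) (d (.var 3)) (.var 3)
  have := h.realize_eq (tern t (.var 0) (d s) s) (tern t (.var 0) (d (.var 3)) (.var 3))
    (fun N _ hN x => by
      by_cases e : x 0 = x 1 <;> by_cases e' : x 2 = x 3 <;>
        simp [d, s, realize_tern, hN _ _ _, e, e', ite_eq_then_right_else_left])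
    ![a, b, x, y]
  simpa [d, s, realize_tern] using this

/-- The principal congruence of `(a, b)` is the kernel of `t(a, b, ·)`. -/
theorem gen_singleton (h : SatisfiesDiscriminatorIdentities t M) (a b : M) :
    Congruence.gen {(a, b)} =
      Congruence.ofMap (fun x => t.realize ![a, b, x]) (h.funMap_eq a b) := by
  apply le_antisymm
  · rw [Congruence.gen_le_iff]
    rintro _ rfl
    exact (h.outer_eq a b).trans (h.right_eq a b).symm
  · intro x y (hxy : t.realize ![a, b, x] = t.realize ![a, b, y])
    set θ : Congruence L M := Congruence.gen {(a, b)}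
    have hab : θ.toSetoid a b := Congruence.mem_gen (L := L) (p := (a, b)) rfl
    -- Replace the second `a` by `b` in `z = t(a,a,z)`.
    have key (z : M) : θ.toSetoid z (t.realize ![a, b, z]) := by
      have := θ.realize_fin_three_compat t (θ.iseqv.refl a) hab (θ.iseqv.refl z)
      rwa [h.left_eq] at this
    exact θ.iseqv.trans (key x) (hxy ▸ θ.iseqv.symm (key y))

theorem isComplemented_gen_singleton (h : SatisfiesDiscriminatorIdentities t M) (p : M × M) :
    IsComplemented (Congruence.gen (L := L) {p}) := by
  obtain ⟨a, b⟩ := p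
  rw [h.gen_singleton]
  refine ⟨Congruence.ofMap (fun x => t.realize ![a, t.realize ![a, b, x], x])
    (h.funMap_compl_eq a b), IsCompl.of_eq (le_bot_iff.1 fun x y hxy => ?_)
    (top_le_iff.1 fun x y _ => ?_)⟩
  · have h₁ : t.realize ![a, b, x] = t.realize ![a, b, y] :=
      (inf_le_left : _ ⊓ _ ≤ Congruence.ofMap _ (h.funMap_eq a b)) _ _ hxy
    have h₂ : t.realize ![a, t.realize ![a, b, x], x] = t.realize ![a, t.realize ![a, b, y], y] :=
      (inf_le_right : _ ⊓ _ ≤ Congruence.ofMap _ (h.funMap_compl_eq a b)) _ _ hxy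
    change x = y
    rw [← h.recover_eq a b x, ← h.recover_eq a b y, h₂, h₁]
  · exact (Congruence.sup_apply_iff h.left_eq h.right_eq).2
      ⟨_, (h.switch_left_eq a b x y).symm, h.switch_right_eq a b x y⟩

theorem congruenceDistributive (h : SatisfiesDiscriminatorIdentities t M) :
    CongruenceDistributive L M :=
  congruenceDistributive_of_pixley h.left_eq h.right_eq h.outer_eq

theorem booleanCongruences_eq (h : SatisfiesDiscriminatorIdentities t M) (hH : HypH L M) :
    booleanCongruences L M = compactCongruences L M :=
  (booleanCongruences_subset h.left_eq h.right_eq h.congruenceDistributive hH).antisymm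
    (compactCongruences_subset h.congruenceDistributive h.isComplemented_gen_singleton)

end SatisfiesDiscriminatorIdentities

end Discriminator

/-! ### Finite generation in quotients and lifting. -/

section Lifting

variable {L : FirstOrder.Language.{u, v}} [L.IsAlgebraic] {M : Type w} [L.Structure M]

theorem HypH.quotient (hH : HypH L M) (θ : Congruence L M) :
    HypH L (Quotient θ.toSetoid) := by
  obtain ⟨X, hX, htop⟩ := hH
  exact ⟨_, hX.image _, by rw [← Congruence.toQuot_gen, ← htop, Congruence.toQuot_top]⟩

/-- Choosing representatives lifts a finite generating set of the quotient congruence, and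
`toQuot_gen` sends the congruence it generates back to the given one. No identities are needed. -/
theorem Congruence.image_toQuot_compactCongruences (θ : Congruence L M) :
    θ.toQuot '' compactCongruences L M = compactCongruences L (Quotient θ.toSetoid) := by
  ext ψ
  constructor
  · rintro ⟨_, ⟨X, hX, rfl⟩, rfl⟩
    exact ⟨_, hX.image _, θ.toQuot_gen X⟩
  · rintro ⟨Y, hY, rfl⟩
    have hsurj : Function.Surjective
        (Prod.map (Quotient.mk θ.toSetoid) (Quotient.mk θ.toSetoid)) :=
      Quotient.mk_surjective.prodMap Quotient.mk_surjective
    refine ⟨_, ⟨Function.surjInv hsurj '' Y, hY.image _, rfl⟩, ?_⟩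
    rw [θ.toQuot_gen, ← Set.image_comp, (Function.rightInverse_surjInv hsurj).comp_eq_id,
      Set.image_id]

end Lifting

end UnivAlg

theorem mainTheorem4 {L : FirstOrder.Language.{u, v}} [L.IsAlgebraic]
    (D : Set (CategoryTheory.Bundled.{w} L.Structure)) (hD : UnivAlg.IsDiscriminatorClass D)
    (A : CategoryTheory.Bundled.{w} L.Structure) (hA : A ∈ D) [Nonempty A]
    (hH : UnivAlg.HypH L A) :
    UnivAlg.CongruenceDistributive L A ∧
      UnivAlg.booleanCongruences L A = UnivAlg.compactCongruences L A ∧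
      UnivAlg.HasCBLP L A := by
  obtain ⟨t, ht⟩ := hD.exists_term
  have h := ht A hA
  refine ⟨h.congruenceDistributive, h.booleanCongruences_eq hH, fun θ => ?_⟩
  have : Nonempty (Quotient θ.toSetoid) := ‹Nonempty A›.map (Quotient.mk θ.toSetoid)
  rw [UnivAlg.Congruence.HasCBLP, h.booleanCongruences_eq hH,
    (h.quotient θ).booleanCongruences_eq (hH.quotient θ), θ.image_toQuot_compactCongruences]
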